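/- Let $k$ be a commutative ring. Let $\Delta S$ be the category with objects $[n]=\{0,1,\dots,n\}$, $n\ge 0$, whose morphisms $[n]\to[m]$ are the pairs $(\phi,g)$ of a non-decreasing map $\phi:[n]\to[m]$ and a permutation $g$ of $\{0,\dots,n\}$ (an element of $\Sigma_{n+1}^{\mathrm{op}}$). The pair $(\phi,g)$ stands for the tuple $(w_0,\dots,w_m)$ of monomials in non-commuting variables $x_0,\dots,x_n$ given by $w_j=\prod_{p\in\phi^{-1}(j)}x_{g(p)}$ (factors in increasing order of $p$, with $w_j=1$ if $\phi^{-1}(j)=\emptyset$), and composition is substitution of monomials for variables. For a unital associative $k$-algebra $A$, let $B^{sym}_*A:\Delta S\to k\text{-}\mathbf{Mod}$ be the functor $[n]\mapsto A^{\otimes_k (n+1)}$ in which the above morphism sends $a_0\otimes\cdots\otimes a_n$ to $w_0(a_0,\dots,a_n)\otimes\cdots\otimes w_m(a_0,\dots,a_n)$. The symmetric homology of $A$ is $$HS_*(A)=\mathrm{Tor}^{\Delta S}_*\left(\underline{k},B^{sym}_*A\right),$$ that is, the left derived functors of $-\otimes_{\Delta S}B^{sym}_*A$ on functors $\Delta S^{\mathrm{op}}\to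 k\text{-}\mathbf{Mod}$, evaluated at the constant functor $\underline{k}$ with value $k$. **Corollary.** Let $A$ be a unital associative $k$-algebra, and let $[A,A]$ be the $k$-submodule of $A$ spanned by the commutators $xy-yx$. If the two-sided ideal of $A$ generated by $[A,A]$ is all of $A$, then $HS_q(A)=0$ for every $q\ge 0$. In particular, for every unital associative $k$-algebra $A$ (with no condition on its commutators) and every $n>1$, $HS_q(M_n(A))=0$ for every $q\ge 0$. -/

import Mathlib

open CategoryTheory Opposite

open scoped TensorProduct DirectSum

universe u v w

namespace SymmetricHomology

/-! ### The category `ΔS` -/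

/-- The objects of `ΔS` are the ordered sets `[n] = {0, 1, …, n}`, for `n ≥ 0`. -/
structure DeltaS : Type where
  n : ℕ

/-- A morphism `[n] ⟶ [m]` of `ΔS` is a pair `(φ, g)` of a non-decreasing map `φ : [n] → [m]` and
a permutation `g` of `{0, …, n}`, regarded as an element of the opposite of the symmetric group.
It stands for the tuple of monomials in non-commuting variables `x₀, …, xₙ` whose `j`-th entry is
the product of the `x_{g p}` over `p ∈ φ⁻¹ j`, in increasing order of `p`; its underlying map of
sets is `φ ∘ g⁻¹`. -/
@[ext]
structure DeltaS.Hom (a b : DeltaS) : Type where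
  φ : Fin (a.n + 1) →o Fin (b.n + 1)
  g : Equiv.Perm (Fin (a.n + 1))

namespace DeltaS.Hom

/-- The identity `(id, 1)`. -/
def id (a : DeltaS) : Hom a a := ⟨OrderHom.id, 1⟩

/-- The permutation `s` in the factorisation `h⁻¹ ∘ φ = φ' ∘ s⁻¹`, where `φ'` is non-decreasing and
`s` is increasing on the fibres of `φ'`. -/
def swap {a b : DeltaS} (φ : Fin (a.n + 1) →o Fin (b.n + 1)) (h : Equiv.Perm (Fin (b.n + 1))) :
    Equiv.Perm (Fin (a.n + 1)) :=
  Tuple.sort (⇑h.symm ∘ ⇑φ)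

/-- The composite "first `f = (φ, g)`, then `f' = (ψ, h)`": the pair `(ψ ∘ φ', g * s)`, where
`h⁻¹ ∘ φ = φ' ∘ s⁻¹` with `φ'` non-decreasing and `s` increasing on the fibres of `φ'`. This is
substitution of the monomials of `f` for the variables of `f'`. -/
def comp {a b c : DeltaS} (f : Hom a b) (f' : Hom b c) : Hom a c where
  φ := f'.φ.comp ⟨⇑f'.g.symm ∘ ⇑f.φ ∘ ⇑(swap f.φ f'.g), Tuple.monotone_sort (⇑f'.g.symm ∘ ⇑f.φ)⟩
  g := f.g * swap f.φ f'.g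

theorem swap_mono {a b : DeltaS} (φ : Fin (a.n + 1) →o Fin (b.n + 1))
    (h : Equiv.Perm (Fin (b.n + 1))) :
    Monotone fun i => h.symm (φ (swap φ h i)) :=
  Tuple.monotone_sort (⇑h.symm ∘ ⇑φ)

theorem swap_lt {a b : DeltaS} (φ : Fin (a.n + 1) →o Fin (b.n + 1))
    (h : Equiv.Perm (Fin (b.n + 1))) {i j : Fin (a.n + 1)} (hij : i < j)
    (he : φ (swap φ h i) = φ (swap φ h j)) : swap φ h i < swap φ h j :=
  (Tuple.eq_sort_iff.1 (rfl : swap φ h = Tuple.sort (⇑h.symm ∘ ⇑φ))).2 i j hij (by simp [he])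

theorem swap_comp {a b c : DeltaS} (φ : Fin (a.n + 1) →o Fin (b.n + 1)) (f' : Hom b c)
    (l : Equiv.Perm (Fin (c.n + 1))) :
    swap φ f'.g * swap (comp ⟨φ, 1⟩ f').φ l = swap φ (f'.g * swap f'.φ l) := by
  set s₁ := swap φ f'.g with hs₁
  set s₂ := swap (comp ⟨φ, 1⟩ f').φ l with hs₂
  set t₁ := swap f'.φ l with ht₁
  have key : ∀ x, (comp ⟨φ, 1⟩ f').φ x = f'.φ (f'.g.symm (φ (s₁ x))) := fun x => rfl
  unfold swap
  rw [Tuple.eq_sort_iff]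
  constructor
  · intro i j hij
    rcases hij.eq_or_lt with rfl | hij
    · exact le_rfl
    simp only [Function.comp_apply, Equiv.Perm.mul_def, Equiv.symm_trans_apply]
    by_contra! hlt
    have h1 := swap_mono f'.φ l hlt.le
    simp only [← ht₁, Equiv.apply_symm_apply] at h1
    have h2 := swap_mono (comp ⟨φ, 1⟩ f').φ l hij.le
    simp only [← hs₂, key] at h2
    have h3 := l.symm.injective (le_antisymm h1 h2)
    have h4 := swap_lt (comp ⟨φ, 1⟩ f').φ l hij (by simp only [← hs₂, key]; exact h3.symm)
    have h5 := swap_mono φ f'.g h4.le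
    simp only [← hs₁, ← hs₂] at h5
    have h6 := swap_lt f'.φ l hlt (by simp only [← ht₁, Equiv.apply_symm_apply]; exact h3)
    simp only [← ht₁, Equiv.apply_symm_apply] at h6
    exact absurd h5 (not_le.2 h6)
  · intro i j hij he
    simp only [Function.comp_apply, Equiv.Perm.mul_def, Equiv.symm_trans_apply] at he ⊢
    have he' := f'.g.symm.injective (t₁.symm.injective he)
    have h4 := swap_lt (comp ⟨φ, 1⟩ f').φ l hij (congrArg (fun y => f'.φ (f'.g.symm y)) he')
    exact swap_lt φ f'.g h4 he'

end DeltaS.Hom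

instance : Category.{0} DeltaS where
  Hom := DeltaS.Hom
  id := DeltaS.Hom.id
  comp := DeltaS.Hom.comp
  id_comp {a b} f := by
    have h : DeltaS.Hom.swap (a := a) OrderHom.id f.g = f.g := by
      unfold DeltaS.Hom.swap
      rw [eq_comm, Tuple.eq_sort_iff]
      refine ⟨fun i j hij => by simpa using hij, fun i j hij he => ?_⟩
      simp at he
      exact absurd he hij.ne
    ext x
    · simp [DeltaS.Hom.comp, DeltaS.Hom.id, h]
    · simp [DeltaS.Hom.comp, DeltaS.Hom.id, h]
  comp_id {a b} f := by
    have h : DeltaS.Hom.swap f.φ 1 = 1 := by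
      unfold DeltaS.Hom.swap
      exact Tuple.sort_eq_refl_iff_monotone.2 f.φ.monotone
    apply DeltaS.Hom.ext
    · apply OrderHom.ext
      funext x
      change f.φ (DeltaS.Hom.swap f.φ 1 x) = f.φ x
      rw [h]
      rfl
    · simp [DeltaS.Hom.comp, DeltaS.Hom.id, h]
  assoc {a b c d} f f' f'' := by
    have h := DeltaS.Hom.swap_comp f.φ f' f''.g
    have h' : ∀ x, DeltaS.Hom.swap f.φ f'.g
        (DeltaS.Hom.swap (DeltaS.Hom.comp ⟨f.φ, 1⟩ f').φ f''.g x) =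
        DeltaS.Hom.swap f.φ (f'.g * DeltaS.Hom.swap f'.φ f''.g) x :=
      fun x => DFunLike.congr_fun h x
    apply DeltaS.Hom.ext
    · apply OrderHom.ext
      funext x
      change f''.φ (f''.g.symm (f'.φ (f'.g.symm (f.φ (DeltaS.Hom.swap f.φ f'.g
        (DeltaS.Hom.swap (DeltaS.Hom.comp f f').φ f''.g x)))))) =
        f''.φ (f''.g.symm (f'.φ (DeltaS.Hom.swap f'.φ f''.g
          ((f'.g * DeltaS.Hom.swap f'.φ f''.g).symm
            (f.φ (DeltaS.Hom.swap f.φ (f'.g * DeltaS.Hom.swap f'.φ f''.g) x))))))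
      rw [← h' x]
      simp only [Equiv.Perm.mul_def, Equiv.symm_trans_apply, Equiv.apply_symm_apply]
      rfl
    · simp only [DeltaS.Hom.comp] at h ⊢
      rw [mul_assoc, h]

/-! ### The symmetric bar construction -/

/-- The word of the `j`-th monomial of `f = (φ, g)`: the list of the `g p` for `p ∈ φ⁻¹ j`, in
increasing order of `p`. -/
def DeltaS.Hom.word {a b : DeltaS} (f : DeltaS.Hom a b) (j : Fin (b.n + 1)) :
    List (Fin (a.n + 1)) :=
  ((List.finRange (a.n + 1)).filter fun p => f.φ p = j).map f.g

namespace DeltaS.Hom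

theorem mem_word {a b : DeltaS} (f : Hom a b) (j : Fin (b.n + 1)) (i : Fin (a.n + 1)) :
    i ∈ f.word j ↔ f.φ (f.g.symm i) = j := by
  simp only [word, List.mem_map, List.mem_filter, List.mem_finRange, true_and, decide_eq_true_eq]
  constructor
  · rintro ⟨p, hp, rfl⟩
    simpa using hp
  · intro h
    exact ⟨_, h, by simp⟩

theorem nodup_word {a b : DeltaS} (f : Hom a b) (j : Fin (b.n + 1)) : (f.word j).Nodup :=
  ((List.nodup_finRange _).filter _).map f.g.injective

theorem word_id {a : DeltaS} (j : Fin (a.n + 1)) : (id a).word j = [j] := by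
  have : (id a).word j = (List.finRange (a.n + 1)).filter (fun p => p = j) := by
    simp [word, id]
  rw [this]
  rw [List.filter_eq, List.count_eq_one_of_mem (List.nodup_finRange _) (List.mem_finRange j)]
  rfl

theorem word_comp {a b c : DeltaS} (f : Hom a b) (f' : Hom b c) (j : Fin (c.n + 1)) :
    (comp f f').word j = (f'.word j).flatMap f.word := by
  let r : Fin (a.n + 1) → Fin (a.n + 1) → Prop := fun x y =>
    f'.g.symm (f.φ x) < f'.g.symm (f.φ y) ∨ (f'.g.symm (f.φ x) = f'.g.symm (f.φ y) ∧ x < y)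
  have key : ((List.finRange (a.n + 1)).filter fun p => (comp f f').φ p = j).map
        (swap f.φ f'.g) =
      ((List.finRange (b.n + 1)).filter fun q => f'.φ q = j).flatMap fun q =>
        (List.finRange (a.n + 1)).filter fun p => f.φ p = f'.g q := by
    have hl : (((List.finRange (a.n + 1)).filter fun p => (comp f f').φ p = j).map
        (swap f.φ f'.g)).Pairwise r := by
      rw [List.pairwise_map]
      refine List.Pairwise.filter _ ((List.pairwise_lt_finRange _).imp ?_)
      intro x y hxy
      rcases (swap_mono f.φ f'.g hxy.le).lt_or_eq with h | h
      · exact Or.inl h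
      · exact Or.inr ⟨h, swap_lt f.φ f'.g hxy (f'.g.symm.injective h)⟩
    have hr : (((List.finRange (b.n + 1)).filter fun q => f'.φ q = j).flatMap fun q =>
        (List.finRange (a.n + 1)).filter fun p => f.φ p = f'.g q).Pairwise r := by
      rw [List.pairwise_flatMap]
      constructor
      · intro q _
        refine List.Pairwise.imp_of_mem ?_ ((List.pairwise_lt_finRange _).filter _)
        intro x y hx hy hxy
        simp only [List.mem_filter, List.mem_finRange, true_and, decide_eq_true_eq] at hx hy
        exact Or.inr ⟨by rw [hx, hy], hxy⟩
      · refine List.Pairwise.filter _ ((List.pairwise_lt_finRange _).imp ?_)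
        intro q q' hq x hx y hy
        simp only [List.mem_filter, List.mem_finRange, true_and, decide_eq_true_eq] at hx hy
        exact Or.inl (by simpa [hx, hy] using hq)
    have hirr : ∀ x y, r x y → x ≠ y := by
      rintro x y (h | h) rfl
      · exact lt_irrefl _ h
      · exact lt_irrefl _ h.2
    have hperm := (List.perm_ext_iff_of_nodup (hl.imp (hirr _ _)) (hr.imp (hirr _ _))).2 (by
      intro x
      simp only [List.mem_map, List.mem_flatMap, List.mem_filter, List.mem_finRange, true_and,
        decide_eq_true_eq]
      constructor
      · rintro ⟨p, hp, rfl⟩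
        exact ⟨f'.g.symm (f.φ (swap f.φ f'.g p)), hp, by simp⟩
      · rintro ⟨q, hq, hx⟩
        refine ⟨(swap f.φ f'.g).symm x, ?_, by simp⟩
        change f'.φ (f'.g.symm (f.φ (swap f.φ f'.g ((swap f.φ f'.g).symm x)))) = j
        simp [hx, hq])
    refine hperm.eq_of_pairwise ?_ hl hr
    rintro x y _ _ (h | h) (h' | h')
    · exact absurd h h'.not_gt
    · exact absurd h h'.1.symm.not_lt
    · exact absurd h' h.1.symm.not_lt
    · exact absurd h.2 h'.2.not_gt
  have h := congrArg (List.map f.g) key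
  simp only [List.map_map, List.map_flatMap] at h
  simp only [word, List.flatMap_map]
  exact h

end DeltaS.Hom

theorem prod_update_of_notMem {ι : Type*} [DecidableEq ι] {A : Type v} [Monoid A] (L : List ι)
    (x : ι → A) (i : ι) (y : A) (hi : i ∉ L) :
    (L.map (Function.update x i y)).prod = (L.map x).prod := by
  congr 1
  refine List.map_congr_left fun l hl => Function.update_of_ne ?_ _ _
  rintro rfl
  exact hi hl

theorem prod_update_add {ι : Type*} [DecidableEq ι] {A : Type v} [Ring A] (L : List ι)
    (hL : L.Nodup) (x : ι → A) (i : ι) (y z : A) (hi : i ∈ L) :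
    (L.map (Function.update x i (y + z))).prod =
      (L.map (Function.update x i y)).prod + (L.map (Function.update x i z)).prod := by
  induction L with
  | nil => simp at hi
  | cons l L ih =>
    simp only [List.map_cons, List.prod_cons]
    rw [List.nodup_cons] at hL
    rcases eq_or_ne l i with rfl | h
    · simp [prod_update_of_notMem L x l _ hL.1, add_mul]
    · rw [ih hL.2 (by simpa [h.symm] using hi)]
      simp [Function.update_of_ne h, mul_add]

theorem prod_update_smul {k : Type u} [CommRing k] {ι : Type*} [DecidableEq ι] {A : Type v}
    [Ring A] [Algebra k A] (L : List ι) (hL : L.Nodup) (x : ι → A) (i : ι) (c : k) (y : A)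
    (hi : i ∈ L) :
    (L.map (Function.update x i (c • y))).prod = c • (L.map (Function.update x i y)).prod := by
  induction L with
  | nil => simp at hi
  | cons l L ih =>
    simp only [List.map_cons, List.prod_cons]
    rw [List.nodup_cons] at hL
    rcases eq_or_ne l i with rfl | h
    · simp [prod_update_of_notMem L x l _ hL.1]
    · rw [ih hL.2 (by simpa [h.symm] using hi)]
      simp [Function.update_of_ne h]

theorem DeltaS.Hom.prod_word_update {A : Type v} [Ring A] {a b : DeltaS} (f : DeltaS.Hom a b)
    [DecidableEq (Fin (a.n + 1))] (x : Fin (a.n + 1) → A) (i : Fin (a.n + 1)) (y : A) :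
    (fun j => ((f.word j).map (Function.update x i y)).prod) =
      Function.update (fun j => ((f.word j).map x).prod) (f.φ (f.g.symm i))
        ((f.word (f.φ (f.g.symm i))).map (Function.update x i y)).prod := by
  funext j
  rcases eq_or_ne j (f.φ (f.g.symm i)) with rfl | h
  · simp
  · rw [Function.update_of_ne h]
    exact prod_update_of_notMem _ _ _ _ (by rw [mem_word]; exact h.symm)

/-- The map `(a₀, …, aₙ) ↦ b₀ ⊗ ⋯ ⊗ bₘ`, where `bⱼ` is the `j`-th monomial of `f` evaluated at
`a₀, …, aₙ` (an empty monomial has the value `1`). -/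
noncomputable def barMultilinear (k : Type u) [CommRing k] (A : Type v) [Ring A] [Algebra k A]
    {a b : DeltaS} (f : DeltaS.Hom a b) :
    MultilinearMap k (fun _ : Fin (a.n + 1) => A) (⨂[k] _ : Fin (b.n + 1), A) where
  toFun x := PiTensorProduct.tprod k fun j => ((f.word j).map x).prod
  map_update_add' := by
    intro _ x i y z
    have hi : i ∈ f.word (f.φ (f.g.symm i)) := (f.mem_word _ _).2 rfl
    rw [f.prod_word_update, f.prod_word_update x i y, f.prod_word_update x i z,
      prod_update_add _ (f.nodup_word _) _ _ _ _ hi, MultilinearMap.map_update_add]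
  map_update_smul' := by
    intro _ x i c y
    have hi : i ∈ f.word (f.φ (f.g.symm i)) := (f.mem_word _ _).2 rfl
    rw [f.prod_word_update, f.prod_word_update x i y,
      prod_update_smul _ (f.nodup_word _) _ _ _ _ hi, MultilinearMap.map_update_smul]

/-- The symmetric bar construction: the functor `[n] ↦ A ⊗ ⋯ ⊗ A` (`n + 1` factors, over `k`) on
`ΔS`, on which a morphism acts by `a₀ ⊗ ⋯ ⊗ aₙ ↦ b₀ ⊗ ⋯ ⊗ bₘ`, with `bⱼ` the value of its `j`-th
monomial at `a₀, …, aₙ`. -/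
noncomputable def symBar (k : Type u) [CommRing k] (A : Type v) [Ring A] [Algebra k A] :
    DeltaS ⥤ ModuleCat.{max u v} k where
  obj a := ModuleCat.of k (⨂[k] _ : Fin (a.n + 1), A)
  map f := ModuleCat.ofHom (PiTensorProduct.lift (barMultilinear k A f))
  map_id a := by
    apply ModuleCat.hom_ext
    apply PiTensorProduct.ext
    ext x
    have h : ∀ j, DeltaS.Hom.word (𝟙 a : DeltaS.Hom a a) j = [j] := DeltaS.Hom.word_id
    simp [barMultilinear, h]
  map_comp {a b c} f f' := by
    apply ModuleCat.hom_ext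
    apply PiTensorProduct.ext
    ext x
    have h : ∀ j, DeltaS.Hom.word (f ≫ f' : DeltaS.Hom a c) j =
      (DeltaS.Hom.word f' j).flatMap (DeltaS.Hom.word f) := DeltaS.Hom.word_comp f f'
    simp only [LinearMap.compMultilinearMap_apply, ModuleCat.hom_ofHom, ModuleCat.hom_comp,
      LinearMap.comp_apply, PiTensorProduct.lift.tprod]
    simp only [barMultilinear, MultilinearMap.coe_mk, h, PiTensorProduct.lift.tprod]
    congr 1
    funext j
    simp [List.flatMap_def, List.prod_flatten, List.map_map, Function.comp_def]

/-! ### The tensor product of functors and its derived functors -/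

section Tor

variable {k : Type u} [CommRing k] {C : Type} [SmallCategory C]

open scoped Classical in
/-- The submodule of `⨁ c, G c ⊗ F c` spanned by the `x·f ⊗ y - x ⊗ f·y`, for `f : c ⟶ d`,
`x ∈ G d` and `y ∈ F c`. -/
def tensorRel (G : Cᵒᵖ ⥤ ModuleCat.{w} k) (F : C ⥤ ModuleCat.{w} k) :
    Submodule k (⨁ c : C, G.obj (op c) ⊗[k] F.obj c) :=
  Submodule.span k {t | ∃ (c d : C) (f : c ⟶ d) (x : G.obj (op d)) (y : F.obj c),
    t = DirectSum.of (fun c : C => G.obj (op c) ⊗[k] F.obj c) c ((G.map f.op).hom x ⊗ₜ[k] y) -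
      DirectSum.of (fun c : C => G.obj (op c) ⊗[k] F.obj c) d (x ⊗ₜ[k] (F.map f).hom y)}

/-- The map on `⨁ c, G c ⊗ F c` induced by a natural transformation in the variable `G`. -/
noncomputable def tensorSumMap {G G' : Cᵒᵖ ⥤ ModuleCat.{w} k} (α : G ⟶ G')
    (F : C ⥤ ModuleCat.{w} k) :
    (⨁ c : C, G.obj (op c) ⊗[k] F.obj c) →ₗ[k] (⨁ c : C, G'.obj (op c) ⊗[k] F.obj c) :=
  DirectSum.lmap fun c => TensorProduct.map (α.app (op c)).hom LinearMap.id

theorem tensorRel_le_comap {G G' : Cᵒᵖ ⥤ ModuleCat.{w} k} (α : G ⟶ G')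
    (F : C ⥤ ModuleCat.{w} k) :
    tensorRel G F ≤ (tensorRel G' F).comap (tensorSumMap α F) := by
  classical
  refine Submodule.span_le.2 ?_
  rintro _ ⟨c, d, f, x, y, rfl⟩
  refine Submodule.subset_span ⟨c, d, f, (α.app (op d)).hom x, y, ?_⟩
  have h : (α.app (op c)).hom ((G.map f.op).hom x) = (G'.map f.op).hom ((α.app (op d)).hom x) :=
    congrArg (fun φ => φ.hom x) (α.naturality f.op)
  rw [map_sub, ← h]
  simp only [tensorSumMap, DirectSum.lmap_of, TensorProduct.map_tmul, LinearMap.id_coe, id_eq]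

theorem tensorSumMap_id (G : Cᵒᵖ ⥤ ModuleCat.{w} k) (F : C ⥤ ModuleCat.{w} k)
    (x : ⨁ c : C, G.obj (op c) ⊗[k] F.obj c) : tensorSumMap (𝟙 G) F x = x := by
  simp [tensorSumMap]

theorem tensorSumMap_comp {G G' G'' : Cᵒᵖ ⥤ ModuleCat.{w} k} (α : G ⟶ G') (β : G' ⟶ G'')
    (F : C ⥤ ModuleCat.{w} k) (x : ⨁ c : C, G.obj (op c) ⊗[k] F.obj c) :
    tensorSumMap (α ≫ β) F x = tensorSumMap β F (tensorSumMap α F x) := by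
  refine DFinsupp.ext fun c => ?_
  simp only [tensorSumMap, DirectSum.lmap_apply, NatTrans.comp_app, ModuleCat.hom_comp]
  rw [← LinearMap.comp_apply, ← TensorProduct.map_comp, LinearMap.id_comp]

theorem tensorSumMap_add {G G' : Cᵒᵖ ⥤ ModuleCat.{w} k} (α β : G ⟶ G')
    (F : C ⥤ ModuleCat.{w} k) (x : ⨁ c : C, G.obj (op c) ⊗[k] F.obj c) :
    tensorSumMap (α + β) F x = tensorSumMap α F x + tensorSumMap β F x := by
  refine DFinsupp.ext fun c => ?_
  rw [DirectSum.add_apply]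
  simp only [tensorSumMap, DirectSum.lmap_apply, NatTrans.app_add, ModuleCat.hom_add,
    TensorProduct.map_add_left, LinearMap.add_apply]

/-- The functor `G ↦ G ⊗_C F` on contravariant functors `G`, where `G ⊗_C F` is the quotient of
`⨁ c, G c ⊗ F c` by the relations `x·f ⊗ y = x ⊗ f·y`. -/
noncomputable def tensorFunctor (F : C ⥤ ModuleCat.{w} k) :
    (Cᵒᵖ ⥤ ModuleCat.{w} k) ⥤ ModuleCat.{w} k where
  obj G := ModuleCat.of k ((⨁ c : C, G.obj (op c) ⊗[k] F.obj c) ⧸ tensorRel G F)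
  map {G G'} α := ModuleCat.ofHom
    (Submodule.mapQ _ _ (tensorSumMap α F) (tensorRel_le_comap α F))
  map_id G := by
    apply ModuleCat.hom_ext
    apply Submodule.linearMap_qext
    refine LinearMap.ext fun x => congrArg (Submodule.Quotient.mk (p := tensorRel G F)) ?_
    exact tensorSumMap_id G F x
  map_comp {G G' G''} α β := by
    apply ModuleCat.hom_ext
    apply Submodule.linearMap_qext
    refine LinearMap.ext fun x => congrArg (Submodule.Quotient.mk (p := tensorRel G'' F)) ?_
    exact tensorSumMap_comp α β F x

instance (F : C ⥤ ModuleCat.{w} k) : (tensorFunctor F).Additive where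
  map_add {G G' α β} := by
    apply ModuleCat.hom_ext
    apply Submodule.linearMap_qext
    refine LinearMap.ext fun x => congrArg (Submodule.Quotient.mk (p := tensorRel G' F)) ?_
    exact tensorSumMap_add α β F x

instance enoughProjectives_functor [Small.{w} k] {D : Type} [SmallCategory D] :
    EnoughProjectives (D ⥤ ModuleCat.{w} k) where
  presentation X := by
    have : Limits.HasColimitsOfSize.{0, 0} (ModuleCat.{w} k) :=
      Limits.hasColimitsOfSizeShrink.{0, 0, w, w} _
    let π (d : D) : Projective.over (X.obj d) ⟶ X.obj d := Projective.π (X.obj d)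
    let L (d : D) : D ⥤ ModuleCat.{w} k :=
      (evaluationLeftAdjoint (ModuleCat.{w} k) d).obj (Projective.over (X.obj d))
    let adj (d : D) := evaluationAdjunctionRight (ModuleCat.{w} k) d
    let f (d : D) : L d ⟶ X := ((adj d).homEquiv _ _).symm (π d)
    have hL (d : D) : Projective (L d) := by
      apply (adj d).map_projective
      infer_instance
    have hc : Limits.HasCoproduct L := inferInstance
    have hP : Projective (∐ L) := ⟨fun g e _ =>
      ⟨Limits.Sigma.desc fun d => Projective.factorThru (Limits.Sigma.ι L d ≫ g) e,
        Limits.Sigma.hom_ext _ _ fun d => by simp⟩⟩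
    let p : ∐ L ⟶ X := Limits.Sigma.desc f
    have hp (d : D) : Epi (p.app d) := by
      have h : (adj d).unit.app _ ≫ (f d).app d = π d := by
        have := ((adj d).homEquiv _ _).apply_symm_apply (π d)
        rwa [Adjunction.homEquiv_unit] at this
      have h' : ((adj d).unit.app _ ≫ (Limits.Sigma.ι L d).app d) ≫
          p.app d = π d := by
        rw [Category.assoc, ← NatTrans.comp_app, Limits.Sigma.ι_desc]
        exact h
      have : Epi (π d) := Projective.π_epi _
      exact epi_of_epi_fac h'
    have hep : Epi p := NatTrans.epi_of_epi_app p
    exact ⟨{ p := ∐ L, projective := hP, f := p, epi := hep }⟩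

/-- `Torₙ(G, F)` over `C`: the `n`-th left derived functor of `- ⊗_C F`, evaluated at `G`. -/
noncomputable def tor [Small.{w} k] (n : ℕ) (G : Cᵒᵖ ⥤ ModuleCat.{w} k)
    (F : C ⥤ ModuleCat.{w} k) : ModuleCat.{w} k :=
  ((tensorFunctor F).leftDerived n).obj G

end Tor

/-! ### Symmetric homology -/

/-- The symmetric homology `HSₙ(A)` of a unital associative `k`-algebra `A`: the `n`-th `Tor` over
`ΔS` of the constant contravariant functor with value `k` and the symmetric bar construction. -/
noncomputable def HS (k : Type u) [CommRing k] (A : Type v) [Ring A] [Algebra k A] (n : ℕ) :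
    ModuleCat.{max u v} k :=
  tor n ((Functor.const DeltaSᵒᵖ).obj (ModuleCat.of k (ULift.{v} k))) (symBar k A)

/-- The submodule `[A, A]` of `A` spanned by the commutators `x * y - y * x`. -/
def commutatorSubmodule (k : Type u) [CommRing k] (A : Type v) [Ring A] [Algebra k A] :
    Submodule k A :=
  Submodule.span k {z | ∃ x y : A, z = x * y - y * x}

end SymmetricHomology

/-!
Inserting an element of `A` as an additional tensor factor induces an endomorphism of `HS_q(A)`, the
`action` of that element. The action is additive, `1` acts as the identity, and a product acts in
the same way whatever the order of its factors. Hence every element of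
the two-sided ideal generated by the commutators acts as `0`, and if `1` lies in this ideal, the
identity of `HS_q(A)` is zero.

The action comes from a general construction. Let `T` be an endofunctor of a small category `C`,
and let `μ : F ⟶ F ∘ T` be a natural transformation. Take a projective resolution `P` of a constant
contravariant functor. Then `P ∘ T` is an acyclic complex with the same augmentation, so there is a
chain map `P ⟶ P ∘ T`, unique up to homotopy, and the composite
`P ⊗_C F ⟶ (P ∘ T) ⊗_C F ⟶ P ⊗_C F`, whose second map is `x ⊗ y ↦ x ⊗ μ y`, induces an endomorphism
`torMap` of `Tor` that is additive in `μ`. The defining relations of `⊗_C` together with the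
uniqueness of the lift give homotopy invariance (`torMap_whiskerRight`): for `α : T ⟶ T'`, the
transformation `μ` and its extension `F α ∘ μ : F ⟶ F ∘ T'` induce the same endomorphism. Likewise,
`F ι` induces the identity for `ι : 𝟭 C ⟶ T` (`torMap_of_id`).

On `ΔS` let `T_m` adjoin `m` new variables, and let `μ_v` insert the entries of `v ∈ A^m` as tensor
factors. Multiplying the new variables in any prescribed order is a natural transformation
`T_m ⟶ T_1`, which turns `μ_v` into the insertion of the product of the entries of `v` in that order
(`insertion_mulNew`). With `m = 4`, the elements `a * x * y * b` and `a * y * x * b` therefore act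
alike, both as the simultaneous insertion of `a`, `x`, `y` and `b` (`action_mul_commutator_mul`).
The unit acts as the identity because inserting it is the effect of the natural transformation
`𝟭 ⟶ T_1` given by the empty word (`insertion_one`).

In a matrix algebra of size at least `2`, the off-diagonal matrix units are commutators, and they
generate the unit ideal.
-/

namespace SymmetricHomology

/-! ### Comparison of a complex of projectives with an acyclic complex -/

section Comparison

variable {𝒜 : Type*} [Category* 𝒜] [Abelian 𝒜] {P E : ChainComplex 𝒜 ℕ}

/-- An augmentation `p` of a complex of projectives lifts to a chain map into any acyclic augmented
complex `E` with the same target; the terms of `E` need not be projective. -/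
theorem exists_lift [∀ n, Projective (P.X n)] {X : 𝒜} (p : P.X 0 ⟶ X) (hp : P.d 1 0 ≫ p = 0)
    (e : E.X 0 ⟶ X) (hE : Epi e) (he : E.d 1 0 ≫ e = 0) (h₀ : (ShortComplex.mk _ _ he).Exact)
    (h : ∀ n, (ShortComplex.mk _ _ (E.d_comp_d (n + 2) (n + 1) n)).Exact) :
    ∃ l : P ⟶ E, l.f 0 ≫ e = p := by
  have h₁ : (P.d 1 0 ≫ Projective.factorThru p e) ≫ e = 0 := by simp [hp]
  refine ⟨ChainComplex.mkHom _ _ (Projective.factorThru p e) (h₀.liftFromProjective _ h₁)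
    (h₀.liftFromProjective_comp _ h₁) fun n ⟨g, g', c⟩ =>
      ⟨(h n).liftFromProjective (P.d (n + 2) (n + 1) ≫ g') (by simp [c]),
        (h n).liftFromProjective_comp _ _⟩, by simp⟩

/-- Two chain maps from a complex of projectives to an acyclic augmented complex are homotopic as
soon as they agree after augmentation. -/
theorem nonempty_homotopy [∀ n, Projective (P.X n)] {X : 𝒜} (e : E.X 0 ⟶ X)
    (he : E.d 1 0 ≫ e = 0) (h₀ : (ShortComplex.mk _ _ he).Exact)
    (h : ∀ n, (ShortComplex.mk _ _ (E.d_comp_d (n + 2) (n + 1) n)).Exact) (l l' : P ⟶ E)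
    (hl : l.f 0 ≫ e = l'.f 0 ≫ e) : Nonempty (Homotopy l l') := by
  set f := l - l' with hf
  have hf₀ : f.f 0 ≫ e = 0 := by simp [hf, hl]
  have c₀ : h₀.liftFromProjective (f.f 0) hf₀ ≫ E.d 1 0 = f.f 0 :=
    h₀.liftFromProjective_comp _ _
  have hf₁ : (f.f 1 - P.d 1 0 ≫ h₀.liftFromProjective (f.f 0) hf₀) ≫ E.d 1 0 = 0 := by
    rw [Preadditive.sub_comp, Category.assoc, c₀, HomologicalComplex.Hom.comm, sub_self]
  have c₁ : (h 0).liftFromProjective _ hf₁ ≫ E.d 2 1 = _ := (h 0).liftFromProjective_comp _ _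
  refine ⟨Homotopy.equivSubZero.symm (Homotopy.mkInductive f
    (h₀.liftFromProjective (f.f 0) hf₀) c₀.symm ((h 0).liftFromProjective _ hf₁)
    (by rw [c₁]; abel) fun n ⟨g, g', c⟩ =>
      ⟨(h (n + 1)).liftFromProjective (f.f (n + 2) - P.d _ _ ≫ g') (by simp [c]), ?_⟩)⟩
  have := (h (n + 1)).liftFromProjective_comp (f.f (n + 2) - P.d _ _ ≫ g') (by simp [c])
  dsimp only at this
  rw [this]
  abel

end Comparison

/-! ### Reindexing the tensor product of functors along an endofunctor -/

section Reindexing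

variable {k : Type u} [CommRing k] {C : Type} [SmallCategory C]

section Generators

variable {G : Cᵒᵖ ⥤ ModuleCat.{w} k} {F : C ⥤ ModuleCat.{w} k}

open scoped Classical in
/-- The class of `x ⊗ y` in `G ⊗_C F`, for `x ∈ G c` and `y ∈ F c`. -/
noncomputable def tensorMk (c : C) (x : G.obj (op c)) (y : F.obj c) :
    (tensorFunctor F).obj G :=
  Submodule.Quotient.mk (p := tensorRel G F)
    (DirectSum.of (fun c : C => G.obj (op c) ⊗[k] F.obj c) c (x ⊗ₜ[k] y))

theorem tensorMk_map {c d : C} (f : c ⟶ d) (x : G.obj (op d)) (y : F.obj c) :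
    tensorMk (F := F) c ((G.map f.op).hom x) y = tensorMk (G := G) d x ((F.map f).hom y) :=
  (Submodule.Quotient.eq _).2 (Submodule.subset_span ⟨c, d, f, x, y, rfl⟩)

theorem tensorMk_add (c : C) (x : G.obj (op c)) (y y' : F.obj c) :
    tensorMk c x (y + y') = tensorMk c x y + tensorMk c x y' := by
  simp only [tensorMk, TensorProduct.tmul_add, map_add, Submodule.Quotient.mk_add]
  rfl

open scoped Classical in
theorem tensorFunctor_hom_ext {M : ModuleCat.{w} k} {f g : (tensorFunctor F).obj G ⟶ M}
    (h : ∀ c x y, f.hom (tensorMk c x y) = g.hom (tensorMk c x y)) : f = g := by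
  apply ModuleCat.hom_ext
  apply Submodule.linearMap_qext
  apply DirectSum.linearMap_ext
  intro c
  apply TensorProduct.ext'
  intro x y
  exact h c x y

@[simp]
theorem tensorFunctor_map_tensorMk {G' : Cᵒᵖ ⥤ ModuleCat.{w} k} (β : G ⟶ G') (c : C)
    (x : G.obj (op c)) (y : F.obj c) :
    ((tensorFunctor F).map β).hom (tensorMk c x y) = tensorMk c ((β.app (op c)).hom x) y := by
  classical
  refine congrArg (Submodule.Quotient.mk (p := tensorRel G' F)) ?_
  simp [tensorSumMap, DirectSum.lmap_of]

end Generators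

/-- The functor `G ↦ G ∘ T` on contravariant functors. -/
abbrev precomp (T : C ⥤ C) : (Cᵒᵖ ⥤ ModuleCat.{w} k) ⥤ (Cᵒᵖ ⥤ ModuleCat.{w} k) :=
  (Functor.whiskeringLeft _ _ _).obj T.op

/-- The natural transformation `G ∘ T' ⟶ G ∘ T` induced by `α : T ⟶ T'`. -/
abbrev precompMap {T T' : C ⥤ C} (α : T ⟶ T') :
    precomp (k := k) T' ⟶ precomp.{u, w} T :=
  (Functor.whiskeringLeft _ _ _).map (NatTrans.op α)

variable {F : C ⥤ ModuleCat.{w} k}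

open scoped Classical in
/-- The map `(G ∘ T) ⊗_C F ⟶ G ⊗_C F` sending the class of `x ⊗ y`, for `x ∈ G (T c)` and
`y ∈ F c`, to the class of `x ⊗ μ y`. -/
noncomputable def tensorReindexApp (T : C ⥤ C) (μ : F ⟶ T ⋙ F) (G : Cᵒᵖ ⥤ ModuleCat.{w} k) :
    (tensorFunctor F).obj (T.op ⋙ G) ⟶ (tensorFunctor F).obj G :=
  ModuleCat.ofHom <| Submodule.mapQ (tensorRel (T.op ⋙ G) F) (tensorRel G F)
    (DirectSum.toModule k C (⨁ c : C, G.obj (op c) ⊗[k] F.obj c) fun c =>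
      DirectSum.lof k C (fun c : C => G.obj (op c) ⊗[k] F.obj c) (T.obj c) ∘ₗ
        TensorProduct.map LinearMap.id (μ.app c).hom) <| by
    refine Submodule.span_le.2 ?_
    rintro _ ⟨c, d, f, x, y, rfl⟩
    refine Submodule.subset_span ⟨T.obj c, T.obj d, T.map f, x, (μ.app c).hom y, ?_⟩
    have h : (μ.app d).hom ((F.map f).hom y) = (F.map (T.map f)).hom ((μ.app c).hom y) :=
      congrArg (fun φ => φ.hom y) (μ.naturality f)
    rw [map_sub, ← h]
    simp only [← DirectSum.lof_eq_of k, DirectSum.toModule_lof]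
    rfl

@[simp]
theorem tensorReindexApp_tensorMk (T : C ⥤ C) (μ : F ⟶ T ⋙ F) (G : Cᵒᵖ ⥤ ModuleCat.{w} k) (c : C)
    (x : G.obj (op (T.obj c))) (y : F.obj c) :
    (tensorReindexApp T μ G).hom (tensorMk (G := T.op ⋙ G) c x y) =
      tensorMk (T.obj c) x ((μ.app c).hom y) := by
  classical
  refine congrArg (Submodule.Quotient.mk (p := tensorRel G F)) ?_
  rw [← DirectSum.lof_eq_of k, ← DirectSum.lof_eq_of k, DirectSum.toModule_lof]
  rfl

/-- The maps `(G ∘ T) ⊗_C F ⟶ G ⊗_C F` induced by `μ : F ⟶ F ∘ T`, natural in `G`. -/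
noncomputable def tensorReindex (T : C ⥤ C) (μ : F ⟶ T ⋙ F) :
    precomp T ⋙ tensorFunctor F ⟶ tensorFunctor F where
  app G := tensorReindexApp T μ G
  naturality G G' β := by
    apply tensorFunctor_hom_ext
    intro c x y
    change (tensorReindexApp T μ G').hom (((tensorFunctor F).map (Functor.whiskerLeft T.op β)).hom
      (tensorMk (G := T.op ⋙ G) c x y)) = ((tensorFunctor F).map β).hom
        ((tensorReindexApp T μ G).hom (tensorMk (G := T.op ⋙ G) c x y))
    rw [tensorFunctor_map_tensorMk]
    refine (tensorReindexApp_tensorMk _ _ _ _ _ _).trans ?_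
    refine Eq.trans ?_
      (congrArg ((tensorFunctor F).map β).hom (tensorReindexApp_tensorMk T μ G c x y)).symm
    exact (tensorFunctor_map_tensorMk _ _ _ _).symm

theorem tensorReindexApp_add (T : C ⥤ C) (μ ν : F ⟶ T ⋙ F) (G : Cᵒᵖ ⥤ ModuleCat.{w} k) :
    tensorReindexApp T (μ + ν) G = tensorReindexApp T μ G + tensorReindexApp T ν G := by
  apply tensorFunctor_hom_ext
  intro c x y
  rw [ModuleCat.hom_add, LinearMap.add_apply]
  refine (tensorReindexApp_tensorMk _ _ _ _ _ _).trans ?_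
  refine Eq.trans ?_ (congrArg₂ (· + ·) (tensorReindexApp_tensorMk _ _ _ _ _ _)
    (tensorReindexApp_tensorMk _ _ _ _ _ _)).symm
  exact tensorMk_add _ _ _ _

/-- This holds by the defining relations of `G ⊗_C F`, applied to the components of `α`. -/
theorem precompMap_tensorReindexApp {T T' : C ⥤ C} (α : T ⟶ T') (μ : F ⟶ T ⋙ F)
    (G : Cᵒᵖ ⥤ ModuleCat.{w} k) :
    (tensorFunctor F).map ((precompMap α).app G) ≫ tensorReindexApp T μ G =
      tensorReindexApp T' (μ ≫ Functor.whiskerRight α F) G := by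
  apply tensorFunctor_hom_ext
  intro c x y
  rw [ModuleCat.hom_comp, LinearMap.comp_apply, tensorFunctor_map_tensorMk]
  refine (tensorReindexApp_tensorMk _ _ _ _ _ _).trans ?_
  refine Eq.trans ?_ (tensorReindexApp_tensorMk _ _ _ _ _ _).symm
  exact tensorMk_map (α.app c) x _

/-- Along a natural transformation `ι : 𝟭 C ⟶ T`, the map `F ι` induces the action of `ι` on the
contravariant variable. -/
theorem tensorReindexApp_of_id {T : C ⥤ C} (ι : 𝟭 C ⟶ T) (G : Cᵒᵖ ⥤ ModuleCat.{w} k) :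
    tensorReindexApp T (F.leftUnitor.inv ≫ Functor.whiskerRight ι F) G =
      (tensorFunctor F).map ((precompMap ι).app G) := by
  apply tensorFunctor_hom_ext
  intro c x y
  refine (tensorReindexApp_tensorMk _ _ _ _ _ _).trans ?_
  refine Eq.trans ?_ (tensorFunctor_map_tensorMk _ _ _ _).symm
  simp only [NatTrans.comp_app, Functor.leftUnitor_inv_app, Category.id_comp]
  exact (tensorMk_map (ι.app c) x _).symm

theorem map_comp_precompMap_tensorReindexApp {T T' : C ⥤ C} (α : T ⟶ T') (μ : F ⟶ T ⋙ F)
    {G H : Cᵒᵖ ⥤ ModuleCat.{w} k} (l : H ⟶ T'.op ⋙ G) :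
    (tensorFunctor F).map (l ≫ (precompMap α).app G) ≫ tensorReindexApp T μ G =
      (tensorFunctor F).map l ≫ tensorReindexApp T' (μ ≫ Functor.whiskerRight α F) G := by
  rw [← precompMap_tensorReindexApp, ← Category.assoc]
  exact congrArg (· ≫ _) ((tensorFunctor F).map_comp _ _)

theorem map_comp_precompMap_of_id {T : C ⥤ C} (ι : 𝟭 C ⟶ T)
    {G H : Cᵒᵖ ⥤ ModuleCat.{w} k} (l : H ⟶ T.op ⋙ G) :
    (tensorFunctor F).map (l ≫ (precompMap ι).app G) =
      (tensorFunctor F).map l ≫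
        tensorReindexApp T (F.leftUnitor.inv ≫ Functor.whiskerRight ι F) G := by
  rw [tensorReindexApp_of_id]
  exact (tensorFunctor F).map_comp _ _

end Reindexing

/-! ### The operations on `Tor` induced by an endofunctor -/

section Operations

variable {k : Type u} [CommRing k] {C : Type} [SmallCategory C]

variable {M : ModuleCat.{w} k}
  (P : ProjectiveResolution ((Functor.const Cᵒᵖ).obj M)) {F : C ⥤ ModuleCat.{w} k}

/-- The complex `P ∘ T`. -/
noncomputable abbrev precompComplex (T : C ⥤ C) : ChainComplex (Cᵒᵖ ⥤ ModuleCat.{w} k) ℕ :=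
  ((precomp T).mapHomologicalComplex _).obj P.complex

/-- The augmentation of `P ∘ T`: it ends in the same constant functor as that of `P`. -/
noncomputable abbrev precompAugmentation (T : C ⥤ C) :
    (precompComplex P T).X 0 ⟶ (Functor.const Cᵒᵖ).obj M :=
  (precomp T).map (P.π.f 0)

theorem precomp_d_comp_augmentation (T : C ⥤ C) :
    (precompComplex P T).d 1 0 ≫ precompAugmentation P T = 0 :=
  ((ShortComplex.mk _ _ P.complex_d_comp_π_f_zero).map (precomp T)).zero

theorem precomp_exact₀ (T : C ⥤ C) :
    (ShortComplex.mk _ _ (precomp_d_comp_augmentation P T)).Exact :=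
  P.exact₀.map (precomp T)

theorem precomp_exact_succ (T : C ⥤ C) (n : ℕ) :
    (ShortComplex.mk _ _ ((precompComplex P T).d_comp_d (n + 2) (n + 1) n)).Exact :=
  (P.exact_succ n).map (precomp T)

theorem exists_lift_precomp (T : C ⥤ C) :
    ∃ l : P.complex ⟶ precompComplex P T, l.f 0 ≫ precompAugmentation P T = P.π.f 0 := by
  exact exists_lift (P.π.f 0) P.complex_d_comp_π_f_zero (precompAugmentation P T)
    ((precomp T).map_epi (P.π.f 0)) (precomp_d_comp_augmentation P T) (precomp_exact₀ P T) (precomp_exact_succ P T)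

/-- A chain map `P ⟶ P ∘ T` over the identity of the constant functor resolved by `P`. Any two such
maps are homotopic. -/
noncomputable def precompLift (T : C ⥤ C) : P.complex ⟶ precompComplex P T :=
  (exists_lift_precomp P T).choose

theorem precompLift_augmentation (T : C ⥤ C) :
    (precompLift P T).f 0 ≫ precompAugmentation P T = P.π.f 0 :=
  (exists_lift_precomp P T).choose_spec

/-- The chain map `P ∘ T' ⟶ P ∘ T` induced by `α : T ⟶ T'`. -/
noncomputable abbrev precompComplexMap {T T' : C ⥤ C} (α : T ⟶ T') :
    precompComplex P T' ⟶ precompComplex P T :=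
  (NatTrans.mapHomologicalComplex (precompMap α) _).app P.complex

theorem precompComplexMap_augmentation {T T' : C ⥤ C} (α : T ⟶ T') :
    (precompComplexMap P α).f 0 ≫ precompAugmentation P T = precompAugmentation P T' := by
  refine ((precompMap α).naturality (P.π.f 0)).symm.trans ?_
  ext c : 2
  exact Category.comp_id _

theorem homotopy_precompLift {T T' : C ⥤ C} (α : T ⟶ T') :
    Nonempty (Homotopy (precompLift P T' ≫ precompComplexMap P α) (precompLift P T)) :=
  nonempty_homotopy (precompAugmentation P T) (precomp_d_comp_augmentation P T)
    (precomp_exact₀ P T) (precomp_exact_succ P T) _ _ (by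
      rw [HomologicalComplex.comp_f, Category.assoc, precompComplexMap_augmentation,
        precompLift_augmentation, precompLift_augmentation])

/-- The chain map `P ⊗_C F ⟶ (P ∘ T) ⊗_C F ⟶ P ⊗_C F` induced by `μ : F ⟶ F ∘ T`. -/
noncomputable def tensorComplexMap (T : C ⥤ C) (μ : F ⟶ T ⋙ F) :
    ((tensorFunctor F).mapHomologicalComplex _).obj P.complex ⟶
      ((tensorFunctor F).mapHomologicalComplex _).obj P.complex :=
  ((tensorFunctor F).mapHomologicalComplex _).map (precompLift P T) ≫
    (NatTrans.mapHomologicalComplex (tensorReindex T μ) _).app P.complex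

theorem tensorComplexMap_add (T : C ⥤ C) (μ ν : F ⟶ T ⋙ F) :
    tensorComplexMap P T (μ + ν) = tensorComplexMap P T μ + tensorComplexMap P T ν := by
  ext n : 1
  exact (congrArg _ (tensorReindexApp_add T μ ν (P.complex.X n))).trans (Preadditive.comp_add ..)

theorem homotopy_tensorComplexMap {T T' : C ⥤ C} (α : T ⟶ T') (μ : F ⟶ T ⋙ F) :
    Nonempty (Homotopy (tensorComplexMap P T' (μ ≫ Functor.whiskerRight α F))
      (tensorComplexMap P T μ)) := by
  obtain ⟨h⟩ := homotopy_precompLift P α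
  have h' := ((tensorFunctor F).mapHomotopy h).compRight
    ((NatTrans.mapHomologicalComplex (tensorReindex T μ) _).app P.complex)
  refine ⟨(Homotopy.ofEq ?_).trans h'⟩
  ext n : 1
  exact (map_comp_precompMap_tensorReindexApp α μ ((precompLift P T').f n)).symm

/-- For `T` receiving a natural transformation `ι` from the identity, `F ι` induces a chain map
homotopic to the identity. -/
theorem homotopy_tensorComplexMap_id {T : C ⥤ C} (ι : 𝟭 C ⟶ T) :
    Nonempty (Homotopy (tensorComplexMap P T (F.leftUnitor.inv ≫ Functor.whiskerRight ι F))
      (𝟙 _)) := by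
  obtain ⟨h⟩ := nonempty_homotopy (P.π.f 0) P.complex_d_comp_π_f_zero P.exact₀ P.exact_succ
    (precompLift P T ≫ precompComplexMap P ι) (𝟙 _) (by
      refine (Category.assoc _ _ _).trans ?_
      refine (congrArg _ (precompComplexMap_augmentation P ι)).trans ?_
      exact (precompLift_augmentation P T).trans (Category.id_comp _).symm)
  refine ⟨(Homotopy.ofEq ?_).trans (((tensorFunctor F).mapHomotopy h).trans
    (Homotopy.ofEq (CategoryTheory.Functor.map_id _ _)))⟩
  ext n : 1
  exact (map_comp_precompMap_of_id ι ((precompLift P T).f n)).symm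

variable [Small.{w} k]

/-- `Torₙ(M, F)` as the homology of `P ⊗_C F`, for the chosen projective resolution `P` of `M`. -/
noncomputable def torIso (n : ℕ) (M : ModuleCat.{w} k) (F : C ⥤ ModuleCat.{w} k) :
    tor n ((Functor.const Cᵒᵖ).obj M) F ≅
      (((tensorFunctor F).mapHomologicalComplex _).obj
        (projectiveResolution ((Functor.const Cᵒᵖ).obj M)).complex).homology n :=
  (projectiveResolution ((Functor.const Cᵒᵖ).obj M)).isoLeftDerivedObj (tensorFunctor F) n

/-- The endomorphism of `Torₙ(M, F)`, for a constant functor `M`, induced by an endofunctor `T` of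
`C` and a natural transformation `μ : F ⟶ F ∘ T`. -/
noncomputable def torMap (n : ℕ) (M : ModuleCat.{w} k) (T : C ⥤ C) (μ : F ⟶ T ⋙ F) :
    tor n ((Functor.const Cᵒᵖ).obj M) F ⟶ tor n ((Functor.const Cᵒᵖ).obj M) F :=
  (torIso n M F).hom ≫ HomologicalComplex.homologyMap (tensorComplexMap _ T μ) n ≫
    (torIso n M F).inv

theorem torMap_add (n : ℕ) (T : C ⥤ C) (μ ν : F ⟶ T ⋙ F) :
    torMap n M T (μ + ν) = torMap n M T μ + torMap n M T ν := by
  rw [torMap, tensorComplexMap_add, HomologicalComplex.homologyMap_add, Preadditive.add_comp,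
    Preadditive.comp_add]
  rfl

/-- Homotopy invariance: extending `μ` along a natural transformation `α : T ⟶ T'` of endofunctors
does not change the induced endomorphism of `Tor`. -/
theorem torMap_whiskerRight (n : ℕ) {T T' : C ⥤ C} (α : T ⟶ T') (μ : F ⟶ T ⋙ F) :
    torMap n M T' (μ ≫ Functor.whiskerRight α F) = torMap n M T μ := by
  obtain ⟨h⟩ := homotopy_tensorComplexMap (projectiveResolution ((Functor.const Cᵒᵖ).obj M)) α μ
  rw [torMap, h.homologyMap_eq, torMap]

/-- Normalisation: the endomorphism of `Tor` induced by `F ι`, for `ι : 𝟭 C ⟶ T`, is the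
identity. -/
theorem torMap_of_id (n : ℕ) {T : C ⥤ C} (ι : 𝟭 C ⟶ T) :
    torMap n M T (F.leftUnitor.inv ≫ Functor.whiskerRight ι F) = 𝟙 _ := by
  obtain ⟨h⟩ := homotopy_tensorComplexMap_id (F := F)
    (projectiveResolution ((Functor.const Cᵒᵖ).obj M)) ι
  rw [torMap, h.homologyMap_eq, HomologicalComplex.homologyMap_id, Category.id_comp,
    Iso.hom_inv_id]

end Operations

/-! ### Morphisms of `ΔS` as tuples of words -/

namespace DeltaS.Hom

/-- A morphism of `ΔS` is determined by its words. -/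
theorem ext_word {a b : DeltaS} {f f' : Hom a b} (h : ∀ j, f.word j = f'.word j) : f = f' := by
  have hκ : ∀ i, f.φ (f.g.symm i) = f'.φ (f'.g.symm i) := fun i => by
    rw [eq_comm, ← mem_word, ← h, mem_word]
  have hφ : f.φ = f'.φ := by
    have key : ⇑f'.φ = ⇑f.φ ∘ ⇑(f'.g.trans f.g.symm) := by
      funext p
      simpa using (hκ (f'.g p)).symm
    refine OrderHom.ext _ _ ?_
    rw [key]
    -- `f'.φ` and `f.φ` are non-decreasing rearrangements of one tuple, hence equal
    exact Tuple.unique_monotone (σ := 1) f.φ.monotone (by rw [← key]; exact f'.φ.monotone)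
  refine Hom.ext hφ (Equiv.ext fun p => ?_)
  have hp := h (f.φ p)
  rw [word, word, ← hφ, List.map_inj_left] at hp
  exact hp p (by simp)

theorem flatMap_eq_of_eq_nil {α β : Type*} {l : List α} (hl : l.Nodup) {j : α} (hj : j ∈ l)
    (t : α → List β) (ht : ∀ i, i ≠ j → t i = []) : l.flatMap t = t j := by
  induction l with
  | nil => simp at hj
  | cons i l ih =>
    rw [List.nodup_cons] at hl
    rw [List.flatMap_cons]
    rcases eq_or_ne i j with rfl | hij
    · have : l.flatMap t = [] := List.flatMap_eq_nil_iff.2 fun x hx => ht x (by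
        rintro rfl
        exact hl.1 hx)
      rw [this, List.append_nil]
    · rw [ht i hij, List.nil_append, ih hl.2 ((List.mem_cons.1 hj).resolve_left hij.symm)]

/-- A tuple of words in which each variable occurs exactly once, `κ i` being the index of the word
that contains the variable `i`, is the tuple of words of a morphism of `ΔS`. -/
theorem exists_word_eq {a b : DeltaS} (w : Fin (b.n + 1) → List (Fin (a.n + 1)))
    (κ : Fin (a.n + 1) → Fin (b.n + 1)) (hκ : ∀ j i, i ∈ w j ↔ κ i = j) (hw : ∀ j, (w j).Nodup) :
    ∃ f : Hom a b, f.word = w := by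
  -- The permutation lists the variables in the order in which the words, read one after another,
  -- mention them.
  let L := (List.finRange (b.n + 1)).flatMap w
  have hL : L.Nodup := by
    refine List.nodup_flatMap.2 ⟨fun j _ => hw j, (List.nodup_finRange _).imp fun hne => ?_⟩
    intro i hi hi'
    exact hne (((hκ _ _).1 hi).symm.trans ((hκ _ _).1 hi'))
  have hmem : ∀ i, i ∈ L := fun i =>
    List.mem_flatMap.2 ⟨κ i, List.mem_finRange _, (hκ _ _).2 rfl⟩
  have hlen : a.n + 1 = L.length := by
    have := List.toFinset_card_of_nodup hL
    rw [← this, Finset.eq_univ_of_forall fun i => List.mem_toFinset.2 (hmem i), Finset.card_univ,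
      Fintype.card_fin]
  let g : Equiv.Perm (Fin (a.n + 1)) :=
    (finCongr hlen).trans (hL.getEquivOfForallMemList L hmem)
  have hg : (List.finRange (a.n + 1)).map g = L := by
    refine List.ext_getElem (by simp [hlen]) fun n h₁ h₂ => ?_
    simp [g]
  have hsorted : (L.map κ).Pairwise (· ≤ ·) := by
    rw [List.pairwise_map, List.pairwise_flatMap]
    refine ⟨fun j _ => (hw j).imp_of_mem fun hx hy _ => ?_,
      (List.pairwise_lt_finRange _).imp fun hlt x hx y hy => ?_⟩
    · rw [(hκ _ _).1 hx, (hκ _ _).1 hy]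
    · rw [(hκ _ _).1 hx, (hκ _ _).1 hy]
      exact hlt.le
  have hmono : Monotone (κ ∘ g) := by
    rw [← hg, List.map_map] at hsorted
    intro p q hpq
    rcases hpq.eq_or_lt with rfl | hlt
    · exact le_rfl
    have := List.pairwise_iff_getElem.1 hsorted p q (by simp; omega) (by simp; omega) hlt
    simpa using this
  refine ⟨⟨⟨κ ∘ g, hmono⟩, g⟩, funext fun j => ?_⟩
  have h₁ : ((List.finRange (a.n + 1)).map g).filter (fun i => κ i = j) = w j := by
    rw [hg, List.filter_flatMap, flatMap_eq_of_eq_nil (List.nodup_finRange _) (List.mem_finRange j)]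
    · exact List.filter_eq_self.2 fun i hi => by simpa using (hκ _ _).1 hi
    · intro j' hj'
      exact List.filter_eq_nil_iff.2 fun i hi => by simpa [(hκ _ _).1 hi] using hj'
  rw [← h₁, List.filter_map]
  rfl

/-- `exists_word_eq` with the variables on both sides indexed by arbitrary types. -/
theorem exists_word_equiv {a b : DeltaS} {I J : Type*} (ea : I ≃ Fin (a.n + 1))
    (eb : J ≃ Fin (b.n + 1)) (w : J → List I) (κ : I → J) (hκ : ∀ j i, i ∈ w j ↔ κ i = j)
    (hw : ∀ j, (w j).Nodup) : ∃ f : Hom a b, ∀ j, f.word (eb j) = (w j).map ea := by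
  obtain ⟨f, hf⟩ := exists_word_eq (fun j => (w (eb.symm j)).map ea) (eb ∘ κ ∘ ea.symm)
    (fun j i => by
      rw [← ea.apply_symm_apply i, List.mem_map_of_injective ea.injective, hκ]
      simp [Equiv.eq_symm_apply])
    (fun j => (hw _).map ea.injective)
  exact ⟨f, fun j => by simp [hf]⟩

end DeltaS.Hom

@[simp]
theorem DeltaS.word_id {a : DeltaS} (j : Fin (a.n + 1)) :
    DeltaS.Hom.word (𝟙 a : a ⟶ a) j = [j] :=
  DeltaS.Hom.word_id j

@[simp]
theorem DeltaS.word_comp {a b c : DeltaS} (f : a ⟶ b) (f' : b ⟶ c) (j : Fin (c.n + 1)) :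
    DeltaS.Hom.word (f ≫ f' : a ⟶ c) j =
      (DeltaS.Hom.word f' j).flatMap (DeltaS.Hom.word f) :=
  DeltaS.Hom.word_comp f f' j

/-! ### Adjoining variables -/

namespace DeltaS

/-- The object `[m + n]`, obtained from `c = [n]` by adjoining `m` new variables. -/
def adjoinObj (m : ℕ) (c : DeltaS) : DeltaS := ⟨m + c.n⟩

/-- The variables of `adjoinObj m c`: the `m` new ones, followed by those of `c`. -/
def adjoinEquiv (m : ℕ) (c : DeltaS) : Fin m ⊕ Fin (c.n + 1) ≃ Fin ((adjoinObj m c).n + 1) :=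
  finSumFinEquiv

theorem exists_adjoinMap (m : ℕ) {a b : DeltaS} (f : a ⟶ b) :
    ∃ f' : adjoinObj m a ⟶ adjoinObj m b, ∀ j, Hom.word f' (adjoinEquiv m b j) =
      (Sum.elim (fun i => [Sum.inl i]) (fun j => (Hom.word f j).map Sum.inr) j).map
        (adjoinEquiv m a) := by
  refine Hom.exists_word_equiv _ _ _ (Sum.map _root_.id fun i => f.φ (f.g.symm i)) ?_ ?_
  · rintro (j | j) (i | i) <;> simp [Hom.mem_word]
  · rintro (j | j)
    · simp
    · exact (Hom.nodup_word f j).map Sum.inr_injective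

/-- The morphism that acts as `f` on the old variables and as the identity on the new ones. -/
noncomputable def adjoinMap (m : ℕ) {a b : DeltaS} (f : a ⟶ b) :
    adjoinObj m a ⟶ adjoinObj m b :=
  (exists_adjoinMap m f).choose

@[simp]
theorem word_adjoinMap (m : ℕ) {a b : DeltaS} (f : a ⟶ b) (j : Fin m ⊕ Fin (b.n + 1)) :
    Hom.word (adjoinMap m f) (adjoinEquiv m b j) =
      (Sum.elim (fun i => [Sum.inl i]) (fun j => (Hom.word f j).map Sum.inr) j).map
        (adjoinEquiv m a) :=
  (exists_adjoinMap m f).choose_spec j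

theorem adjoin_hom_ext {m : ℕ} {a b : DeltaS} {f f' : a ⟶ adjoinObj m b}
    (h : ∀ j, Hom.word f (adjoinEquiv m b j) = Hom.word f' (adjoinEquiv m b j)) : f = f' :=
  Hom.ext_word ((adjoinEquiv m b).forall_congr_right.1 h)

/-- The endofunctor of `ΔS` adjoining `m` new variables. -/
noncomputable def adjoin (m : ℕ) : DeltaS ⥤ DeltaS where
  obj := adjoinObj m
  map f := adjoinMap m f
  map_id a := by
    apply adjoin_hom_ext
    rintro (j | j) <;> simp
  map_comp f f' := by
    apply adjoin_hom_ext
    rintro (j | j) <;> simp [List.flatMap_map, List.map_flatMap]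

theorem exists_mulNew {m : ℕ} (W : List (Fin m)) (hW : ∀ i, i ∈ W) (hW' : W.Nodup) (c : DeltaS) :
    ∃ f : adjoinObj m c ⟶ adjoinObj 1 c, ∀ j, Hom.word f (adjoinEquiv 1 c j) =
      (Sum.elim (fun _ => W.map Sum.inl) (fun j => [Sum.inr j]) j).map (adjoinEquiv m c) := by
  refine Hom.exists_word_equiv _ _ _ (Sum.map (fun _ => 0) _root_.id) ?_ ?_
  · rintro (j | j) (i | i) <;> simp [hW, eq_comm, Fin.fin_one_eq_zero]
  · rintro (j | j)
    · exact hW'.map Sum.inl_injective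
    · simp

section

variable {m : ℕ} (W : List (Fin m)) (hW : ∀ i, i ∈ W) (hW' : W.Nodup)

/-- The morphism whose value at the new variable is the product of the `m` new variables in the
order given by the list `W`, and which fixes the old variables. -/
noncomputable def mulNewApp (c : DeltaS) : adjoinObj m c ⟶ adjoinObj 1 c :=
  (exists_mulNew W hW hW' c).choose

@[simp]
theorem word_mulNewApp (c : DeltaS) (j : Fin 1 ⊕ Fin (c.n + 1)) :
    Hom.word (mulNewApp W hW hW' c) (adjoinEquiv 1 c j) =
      (Sum.elim (fun _ => W.map Sum.inl) (fun j => [Sum.inr j]) j).map (adjoinEquiv m c) :=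
  (exists_mulNew W hW hW' c).choose_spec j

/-- The natural transformation replacing `m` new variables by a single one, through their product
in the order given by the list `W`. -/
noncomputable def mulNew : adjoin m ⟶ adjoin 1 where
  app c := mulNewApp W hW hW' c
  naturality a b f := by
    apply adjoin_hom_ext
    rintro (j | j) <;> simp [adjoin, List.flatMap_map] <;> simp [List.map_eq_flatMap]

end

theorem exists_oneNew (c : DeltaS) :
    ∃ f : c ⟶ adjoinObj 1 c, ∀ j, Hom.word f (adjoinEquiv 1 c j) =
      (Sum.elim (fun _ => []) (fun j => [j]) j).map (Equiv.refl _) := by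
  refine Hom.exists_word_equiv _ _ _ Sum.inr ?_ ?_
  · rintro (j | j) i <;> simp [eq_comm]
  · rintro (j | j) <;> simp

/-- The morphism whose value at the new variable is the empty word, and which fixes the old
variables. -/
noncomputable def oneNewApp (c : DeltaS) : c ⟶ adjoinObj 1 c :=
  (exists_oneNew c).choose

@[simp]
theorem word_oneNewApp (c : DeltaS) (j : Fin 1 ⊕ Fin (c.n + 1)) :
    Hom.word (oneNewApp c) (adjoinEquiv 1 c j) = Sum.elim (fun _ => []) (fun j => [j]) j :=
  ((exists_oneNew c).choose_spec j).trans (List.map_id _)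

/-- The natural transformation adjoining a new variable with the empty word as its value. -/
noncomputable def oneNew : 𝟭 DeltaS ⟶ adjoin 1 where
  app c := oneNewApp c
  naturality a b f := by
    apply adjoin_hom_ext
    rintro (j | j) <;> simp [adjoin, List.flatMap_map]

end DeltaS

/-! ### Inserting elements of the algebra -/

section Insert

variable (k : Type u) [CommRing k] {A : Type v} [Ring A] [Algebra k A]

/-- The tensor `x₀ ⊗ ⋯ ⊗ xₙ`, as an element of the symmetric bar construction. -/
noncomputable def barMk {a : DeltaS} (x : Fin (a.n + 1) → A) : (symBar k A).obj a :=
  PiTensorProduct.tprod k x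

theorem symBar_hom_ext {a : DeltaS} {M : ModuleCat.{max u v} k} {f g : (symBar k A).obj a ⟶ M}
    (h : ∀ x, f.hom (barMk k x) = g.hom (barMk k x)) : f = g :=
  ModuleCat.hom_ext (PiTensorProduct.ext (MultilinearMap.ext h))

theorem symBar_map_barMk {a b : DeltaS} (f : a ⟶ b) (x : Fin (a.n + 1) → A) :
    ((symBar k A).map f).hom (barMk k x) =
      barMk k fun j => ((DeltaS.Hom.word f j).map x).prod :=
  PiTensorProduct.lift.tprod (φ := barMultilinear k A f) x

theorem barMk_congr {m : ℕ} {c : DeltaS} {x y : Fin ((DeltaS.adjoinObj m c).n + 1) → A}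
    (h : ∀ j, x (DeltaS.adjoinEquiv m c j) = y (DeltaS.adjoinEquiv m c j)) :
    barMk k x = barMk k y :=
  congrArg _ (funext ((DeltaS.adjoinEquiv m c).forall_congr_right.1 h))

/-- The map `a₀ ⊗ ⋯ ⊗ aₙ ↦ v₁ ⊗ ⋯ ⊗ vₘ ⊗ a₀ ⊗ ⋯ ⊗ aₙ`, as a multilinear map in `v`. -/
noncomputable def insertMultilinear (m : ℕ) (c : DeltaS) :
    MultilinearMap k (fun _ : Fin m => A) (MultilinearMap k (fun _ : Fin (c.n + 1) => A)
      (⨂[k] _ : Fin ((DeltaS.adjoinObj m c).n + 1), A)) :=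
  MultilinearMap.currySum ((PiTensorProduct.tprod k).domDomCongr (DeltaS.adjoinEquiv m c).symm)

/-- The map `a₀ ⊗ ⋯ ⊗ aₙ ↦ v₁ ⊗ ⋯ ⊗ vₘ ⊗ a₀ ⊗ ⋯ ⊗ aₙ`. -/
noncomputable def insertApp {m : ℕ} (v : Fin m → A) (c : DeltaS) :
    (symBar k A).obj c ⟶ (symBar k A).obj (DeltaS.adjoinObj m c) :=
  ModuleCat.ofHom (PiTensorProduct.lift (insertMultilinear k m c v))

theorem insertApp_barMk {m : ℕ} (v : Fin m → A) (c : DeltaS) (x : Fin (c.n + 1) → A) :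
    (insertApp k v c).hom (barMk k x) =
      barMk k fun i => Sum.elim v x ((DeltaS.adjoinEquiv m c).symm i) :=
  PiTensorProduct.lift.tprod (φ := insertMultilinear k m c v) x

/-- The maps `a₀ ⊗ ⋯ ⊗ aₙ ↦ v₁ ⊗ ⋯ ⊗ vₘ ⊗ a₀ ⊗ ⋯ ⊗ aₙ`, as a natural transformation. -/
noncomputable def insertion {m : ℕ} (v : Fin m → A) :
    symBar k A ⟶ DeltaS.adjoin m ⋙ symBar k A where
  app c := insertApp k v c
  naturality a b f := by
    apply symBar_hom_ext
    intro x
    change (insertApp k v b).hom (((symBar k A).map f).hom (barMk k x)) =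
      ((symBar k A).map (DeltaS.adjoinMap m f)).hom ((insertApp k v a).hom (barMk k x))
    rw [symBar_map_barMk, insertApp_barMk, insertApp_barMk, symBar_map_barMk]
    apply barMk_congr
    rintro (j | j) <;> simp [Function.comp_def]

/-- Multiplying the inserted elements in the order given by `W` amounts to inserting their
product. -/
theorem insertion_mulNew {m : ℕ} (v : Fin m → A) (W : List (Fin m)) (hW : ∀ i, i ∈ W)
    (hW' : W.Nodup) :
    insertion k v ≫ Functor.whiskerRight (DeltaS.mulNew W hW hW') (symBar k A) =
      insertion k fun _ : Fin 1 => (W.map v).prod := by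
  apply NatTrans.ext
  funext c
  apply symBar_hom_ext
  intro x
  change ((symBar k A).map (DeltaS.mulNewApp W hW hW' c)).hom
    ((insertApp k v c).hom (barMk k x)) = (insertApp k (fun _ => (W.map v).prod) c).hom (barMk k x)
  rw [insertApp_barMk, insertApp_barMk, symBar_map_barMk]
  apply barMk_congr
  rintro (j | j) <;> simp [Function.comp_def]

/-- Inserting `1` is the effect of adjoining a variable with the empty word as its value. -/
theorem insertion_one :
    (symBar k A).leftUnitor.inv ≫ Functor.whiskerRight DeltaS.oneNew (symBar k A) =
      insertion k fun _ : Fin 1 => (1 : A) := by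
  apply NatTrans.ext
  funext c
  apply symBar_hom_ext
  intro x
  change ((symBar k A).map (DeltaS.oneNewApp c)).hom (barMk k x) =
    (insertApp k (fun _ => 1) c).hom (barMk k x)
  rw [insertApp_barMk, symBar_map_barMk]
  apply barMk_congr
  rintro (j | j) <;> simp

theorem insertion_add (x y : A) :
    insertion k (fun _ : Fin 1 => x + y) = insertion k (fun _ => x) + insertion k fun _ => y := by
  apply NatTrans.ext
  funext c
  apply symBar_hom_ext
  intro z
  have h (t : A) : (fun _ : Fin 1 => t) = Function.update (fun _ => 0) 0 t := by
    funext i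
    rw [Subsingleton.elim i 0, Function.update_self]
  have key : insertMultilinear k 1 c (fun _ => x + y) =
      insertMultilinear k 1 c (fun _ => x) + insertMultilinear k 1 c fun _ => y := by
    rw [h, h x, h y, MultilinearMap.map_update_add]
  change (insertApp k _ c).hom (barMk k z) =
    (insertApp k (fun _ => x) c).hom (barMk k z) + (insertApp k (fun _ => y) c).hom (barMk k z)
  rw [insertApp, key, map_add]
  rfl

end Insert

/-! ### The action of the algebra on its symmetric homology -/

section Action

variable (k : Type u) [CommRing k] (A : Type v) [Ring A] [Algebra k A] (q : ℕ)

/-- The action of `a ∈ A` on `HS_q(A)`, through the insertion of `a` as a tensor factor. -/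
noncomputable def action : A →+ (HS k A q ⟶ HS k A q) :=
  AddMonoidHom.mk' (fun a => torMap q _ (DeltaS.adjoin 1) (insertion k fun _ => a)) fun x y => by
    rw [insertion_add, torMap_add]
    rfl

theorem action_one : action k A q 1 = 𝟙 _ :=
  (congrArg (torMap q _ (DeltaS.adjoin 1)) (insertion_one k).symm).trans (torMap_of_id q _)

/-- The product of `v₁, …, vₘ` in any order acts as the simultaneous insertion of `v₁, …, vₘ`, so
the action does not see the order. -/
theorem action_prod {m : ℕ} (v : Fin m → A) (W : List (Fin m)) (hW : ∀ i, i ∈ W) (hW' : W.Nodup) :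
    action k A q (W.map v).prod = torMap q _ (DeltaS.adjoin m) (insertion k v) :=
  (congrArg (torMap q _ (DeltaS.adjoin 1)) (insertion_mulNew k v W hW hW').symm).trans
    (torMap_whiskerRight q _ _)

theorem action_mul_commutator_mul (a x y b : A) : action k A q (a * (x * y - y * x) * b) = 0 := by
  have h₁ := action_prod k A q ![a, x, y, b] [0, 1, 2, 3] (by decide) (by decide)
  have h₂ := action_prod k A q ![a, x, y, b] [0, 2, 1, 3] (by decide) (by decide)
  have h : action k A q (a * (x * (y * b))) = action k A q (a * (y * (x * b))) := by
    simpa using h₁.trans h₂.symm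
  rw [show a * (x * y - y * x) * b = a * (x * (y * b)) - a * (y * (x * b)) by noncomm_ring,
    map_sub, h, sub_self]

theorem action_eq_zero {z : A}
    (hz : z ∈ TwoSidedIdeal.span (commutatorSubmodule k A : Set A)) : action k A q z = 0 := by
  rw [TwoSidedIdeal.mem_span_iff_mem_addSubgroup_closure] at hz
  suffices h : ∀ c ∈ commutatorSubmodule k A, ∀ a b, action k A q (a * c * b) = 0 by
    refine (AddSubgroup.closure_le (action k A q).ker).2 ?_ hz
    rintro _ ⟨_, ⟨a, -, c, hc, rfl⟩, b, -, rfl⟩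
    exact h c hc a b
  intro c hc
  induction hc using Submodule.span_induction with
  | mem c hc =>
    obtain ⟨x, y, rfl⟩ := hc
    exact fun a b => action_mul_commutator_mul k A q a x y b
  | zero => simp
  | add c c' _ _ h h' =>
    intro a b
    rw [mul_add, add_mul, map_add, h, h', add_zero]
  | smul r c _ h =>
    intro a b
    rw [mul_smul_comm, ← smul_mul_assoc]
    exact h _ _

theorem isZero_HS (h : TwoSidedIdeal.span (commutatorSubmodule k A : Set A) = ⊤) :
    Limits.IsZero (HS k A q) := by
  rw [Limits.IsZero.iff_id_eq_zero, ← action_one]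
  exact action_eq_zero k A q (h ▸ trivial)

end Action

/-! ### Matrix algebras -/

theorem span_commutatorSubmodule_matrix (k : Type u) [CommRing k] (A : Type v) [Ring A]
    [Algebra k A] {n : ℕ} (hn : 1 < n) :
    TwoSidedIdeal.span (commutatorSubmodule k (Matrix (Fin n) (Fin n) A) :
      Set (Matrix (Fin n) (Fin n) A)) = ⊤ := by
  set I := TwoSidedIdeal.span (commutatorSubmodule k (Matrix (Fin n) (Fin n) A) :
    Set (Matrix (Fin n) (Fin n) A))
  have : Nontrivial (Fin n) := Fin.nontrivial_iff_two_le.2 hn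
  have hdiag (i : Fin n) : Matrix.single i i (1 : A) ∈ I := by
    obtain ⟨j, hj⟩ := exists_ne i
    -- for `i ≠ j`, the matrix unit `Eᵢⱼ` is the commutator of `Eᵢᵢ` and `Eᵢⱼ`
    have hij : Matrix.single i j (1 : A) ∈ I := by
      refine TwoSidedIdeal.subset_span (Submodule.subset_span
        ⟨Matrix.single i i 1, Matrix.single i j 1, ?_⟩)
      simp [hj]
    have := I.mul_mem_right _ (Matrix.single j i (1 : A)) hij
    simpa using this
  rw [← TwoSidedIdeal.one_mem_iff]
  have h1 : (1 : Matrix (Fin n) (Fin n) A) = ∑ i, Matrix.single i i 1 := by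
    rw [Matrix.sum_single_eq_diagonal, ← Matrix.diagonal_one]
  rw [h1]
  exact sum_mem fun i _ => hdiag i

end SymmetricHomology

theorem mainTheorem4 (k : Type u) [CommRing k] (A : Type v) [Ring A] [Algebra k A] :
    (TwoSidedIdeal.span (SymmetricHomology.commutatorSubmodule k A : Set A) = ⊤ →
      ∀ q : ℕ, Limits.IsZero (SymmetricHomology.HS k A q)) ∧
    (∀ n : ℕ, 1 < n →
      ∀ q : ℕ, Limits.IsZero (SymmetricHomology.HS k (Matrix (Fin n) (Fin n) A) q)) :=
  ⟨fun h q => SymmetricHomology.isZero_HS k A q h, fun _ hn q =>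
    SymmetricHomology.isZero_HS k _ q
      (SymmetricHomology.span_commutatorSubmodule_matrix k A hn)⟩
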